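/- Let $\Sigma$ be a smooth three-manifold (Hausdorff, second countable, without boundary). A \emph{Cauchy pair} on $\Sigma$ is a pair $(\mathfrak{e},\Theta)$ of a smooth global coframe $\mathfrak{e}=(e_u,e_l,e_n)$ (three smooth one-forms forming a basis of every cotangent space) and a smooth symmetric bilinear form $\Theta\in\Gamma(S^2T^*\Sigma)$. Let $$h_{\mathfrak{e}} = e_u\otimes e_u+e_l\otimes e_l+e_n\otimes e_n$$ be the associated Riemannian metric, $\nabla$ its Levi-Civita connection, and $\Theta(e_a):=\Theta(e_a^\sharp,\cdot)$, where $(e_u^\sharp,e_l^\sharp,e_n^\sharp)$ is the dual frame, which is $h_{\mathfrak{e}}$-orthonormal. The pair is \emph{parallel} if $$\mathrm{d}e_u=\Theta(e_u)\wedge e_u,\qquad \mathrm{d}e_l=\Theta(e_l)\wedge e_u,\qquad \mathrm{d}e_n=\Theta(e_n)\wedge e_u,\qquad(1)$$ $$[\Theta(e_u)]=0\in H^1(\Sigma,\mathbb{R}),\qquad(2)$$ where (2) says that $\Theta(e_u)$ is closed and its de Rham class vanishes. It is \emph{constrained Ricci-flat} if it is parallel and satisfies the Hamiltonian and the momentum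 constraint $$R_{h_{\mathfrak{e}}}=|\Theta|^2_{h_{\mathfrak{e}}}-\mathrm{Tr}_{h_{\mathfrak{e}}}(\Theta)^2\quad(3),\qquad\qquad \mathrm{d}\,\mathrm{Tr}_{h_{\mathfrak{e}}}(\Theta)=\mathrm{div}_{h_{\mathfrak{e}}}(\Theta)\quad(4),$$ where $R_{h_{\mathfrak{e}}}$ is the scalar curvature and $\mathrm{div}_{h_{\mathfrak{e}}}(\Theta)(Y)=\sum_{a\in\{u,l,n\}}(\nabla_{e_a^\sharp}\Theta)(e_a^\sharp,Y)$. The form $\Theta$ is \emph{Codazzi} if $(\nabla_X\Theta)(Y,Z)=(\nabla_Y\Theta)(X,Z)$ for all smooth vector fields $X,Y,Z$. Then a Cauchy pair $(\mathfrak{e},\Theta)$ on $\Sigma$ is a constrained Ricci-flat parallel Cauchy pair if and only if it satisfies (1), (2) and (3). In particular, every parallel Cauchy pair whose form $\Theta$ is Codazzi is constrained Ricci-flat. -/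

import Mathlib

open Bundle Manifold ContDiff VectorField

noncomputable section

namespace CauchyGeometry

section Riemannian

variable {E : Type*} [NormedAddCommGroup E] [NormedSpace ℝ E]
  {H : Type*} [TopologicalSpace H] {I : ModelWithCorners ℝ E H}
  {M : Type*} [TopologicalSpace M] [ChartedSpace H M] [IsManifold I ∞ M]

theorem mdifferentiableAt_inner (g : ContMDiffRiemannianMetric I ∞ E (TangentSpace I : M → Type _))
    {Y Z : ∀ x : M, TangentSpace I x} {x : M}
    (hY : MDiffAt (T% Y) x) (hZ : MDiffAt (T% Z) x) :
    MDiffAt (fun y ↦ g.inner y (Y y) (Z y)) x := by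
  have hg : MDifferentiableAt I (I.prod 𝓘(ℝ, E →L[ℝ] E →L[ℝ] ℝ))
      (fun y ↦ TotalSpace.mk' (E →L[ℝ] E →L[ℝ] ℝ) y (g.inner y)) x :=
    g.contMDiff.mdifferentiableAt (by simp)
  have h : MDifferentiableAt I (I.prod 𝓘(ℝ))
      (fun m ↦ TotalSpace.mk' ℝ (E := Bundle.Trivial M ℝ) m (g.inner m (Y m) (Z m))) x := by
    apply MDifferentiableAt.clm_bundle_apply₂ (F₁ := E) (F₂ := E)
    · exact hg
    · exact hY
    · exact hZ
  simp only [mdifferentiableAt_totalSpace] at h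
  exact h.2

variable [FiniteDimensional ℝ E]

/-- The Koszul expression `2 g(∇_X Y, Z)` of a Riemannian metric `g`. -/
def koszul (g : ContMDiffRiemannianMetric I ∞ E (TangentSpace I : M → Type _))
    (X Y Z : ∀ x : M, TangentSpace I x) (x : M) : ℝ :=
  mvfderiv I (fun y ↦ g.inner y (Y y) (Z y)) x (X x)
    + mvfderiv I (fun y ↦ g.inner y (X y) (Z y)) x (Y x)
    - mvfderiv I (fun y ↦ g.inner y (X y) (Y y)) x (Z x)
    + g.inner x (mlieBracket I X Y x) (Z x)
    - g.inner x (mlieBracket I X Z x) (Y x)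
    - g.inner x (mlieBracket I Y Z x) (X x)

variable (g : ContMDiffRiemannianMetric I ∞ E (TangentSpace I : M → Type _))
  {X X' Y Y' Z Z' : ∀ x : M, TangentSpace I x} {f : M → ℝ} {x : M}

theorem koszul_add_left (hX : MDiffAt (T% X) x) (hX' : MDiffAt (T% X') x)
    (hY : MDiffAt (T% Y) x) (hZ : MDiffAt (T% Z) x) :
    koszul g (X + X') Y Z x = koszul g X Y Z x + koszul g X' Y Z x := by
  have h1 := mvfderiv_add (mdifferentiableAt_inner g hX hZ) (mdifferentiableAt_inner g hX' hZ)
  have h2 := mvfderiv_add (mdifferentiableAt_inner g hX hY) (mdifferentiableAt_inner g hX' hY)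
  simp only [Pi.add_def] at h1 h2
  simp only [koszul, Pi.add_apply, map_add, _root_.add_apply, h1, h2,
    mlieBracket_add_left hX hX']
  ring

theorem koszul_smul_left (hf : MDiffAt f x) (hX : MDiffAt (T% X) x)
    (hY : MDiffAt (T% Y) x) (hZ : MDiffAt (T% Z) x) :
    koszul g (f • X) Y Z x = f x * koszul g X Y Z x := by
  have h1 := mvfderiv_mul hf (mdifferentiableAt_inner g hX hZ)
  have h2 := mvfderiv_mul hf (mdifferentiableAt_inner g hX hY)
  simp only [Pi.mul_def] at h1 h2
  simp [koszul, h1, h2, mlieBracket_smul_left hf hX]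
  ring

theorem koszul_add_right (hX : MDiffAt (T% X) x) (hY : MDiffAt (T% Y) x)
    (hZ : MDiffAt (T% Z) x) (hZ' : MDiffAt (T% Z') x) :
    koszul g X Y (Z + Z') x = koszul g X Y Z x + koszul g X Y Z' x := by
  have h1 := mvfderiv_add (mdifferentiableAt_inner g hX hZ) (mdifferentiableAt_inner g hX hZ')
  have h2 := mvfderiv_add (mdifferentiableAt_inner g hY hZ) (mdifferentiableAt_inner g hY hZ')
  simp only [Pi.add_def] at h1 h2
  simp only [koszul, Pi.add_apply, map_add, _root_.add_apply, h1, h2,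
    mlieBracket_add_right hZ hZ']
  ring

theorem koszul_smul_right (hf : MDiffAt f x) (hX : MDiffAt (T% X) x)
    (hY : MDiffAt (T% Y) x) (hZ : MDiffAt (T% Z) x) :
    koszul g X Y (f • Z) x = f x * koszul g X Y Z x := by
  have h1 := mvfderiv_mul hf (mdifferentiableAt_inner g hX hZ)
  have h2 := mvfderiv_mul hf (mdifferentiableAt_inner g hY hZ)
  simp only [Pi.mul_def] at h1 h2
  simp [koszul, h1, h2, mlieBracket_smul_right hf hZ]
  simp only [g.symm x (Z x)]
  ring

theorem koszul_add_mid (hX : MDiffAt (T% X) x) (hY : MDiffAt (T% Y) x)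
    (hY' : MDiffAt (T% Y') x) (hZ : MDiffAt (T% Z) x) :
    koszul g X (Y + Y') Z x = koszul g X Y Z x + koszul g X Y' Z x := by
  have h1 := mvfderiv_add (mdifferentiableAt_inner g hX hY) (mdifferentiableAt_inner g hX hY')
  have h2 := mvfderiv_add (mdifferentiableAt_inner g hY hZ) (mdifferentiableAt_inner g hY' hZ)
  simp only [Pi.add_def] at h1 h2
  simp only [koszul, Pi.add_apply, map_add, _root_.add_apply, h1, h2,
    mlieBracket_add_left hY hY', mlieBracket_add_right hY hY']
  ring

theorem koszul_smul_mid (hf : MDiffAt f x) (hX : MDiffAt (T% X) x)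
    (hY : MDiffAt (T% Y) x) (hZ : MDiffAt (T% Z) x) :
    koszul g X (f • Y) Z x
      = f x * koszul g X Y Z x + 2 * (mvfderiv I f x (X x) * g.inner x (Y x) (Z x)) := by
  have h1 := mvfderiv_mul hf (mdifferentiableAt_inner g hX hY)
  have h2 := mvfderiv_mul hf (mdifferentiableAt_inner g hY hZ)
  simp only [Pi.mul_def] at h1 h2
  simp [koszul, h1, h2, mlieBracket_smul_left hf hY, mlieBracket_smul_right hf hY]
  simp only [g.symm x (Y x) (X x)]
  ring

/-- The Koszul expression at `x` as a bilinear form in the values of `X` and `Z` at `x`. -/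
def koszulForm (Y : ∀ x : M, TangentSpace I x) (x : M) (hY : MDiffAt (T% Y) x) :
    TangentSpace I x →L[ℝ] TangentSpace I x →L[ℝ] ℝ :=
  TensorialAt.mkHom₂ (F := E) (F' := E) (I := I) (fun X Z ↦ koszul g X Y Z x) x
    (fun _ hZ ↦ ⟨fun hf hX ↦ koszul_smul_left g hf hX hY hZ,
      fun hX hX' ↦ koszul_add_left g hX hX' hY hZ⟩)
    (fun _ hX ↦ ⟨fun hf hZ ↦ koszul_smul_right g hf hX hY hZ,
      fun hZ hZ' ↦ koszul_add_right g hX hY hZ hZ'⟩)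

theorem koszulForm_apply (hX : MDiffAt (T% X) x) (hY : MDiffAt (T% Y) x)
    (hZ : MDiffAt (T% Z) x) : koszulForm g Y x hY (X x) (Z x) = koszul g X Y Z x :=
  TensorialAt.mkHom₂_apply _ _ hX hZ

/-- The musical isomorphism `v ↦ g(v, ·)` of a Riemannian metric. -/
def flat (x : M) : TangentSpace I x ≃L[ℝ] (TangentSpace I x →L[ℝ] ℝ) :=
  have : FiniteDimensional ℝ (TangentSpace I x) := inferInstanceAs (FiniteDimensional ℝ E)
  have : T2Space (TangentSpace I x) := inferInstanceAs (T2Space E)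
  (LinearEquiv.ofInjectiveOfFinrankEq (g.inner x).toLinearMap
    ((injective_iff_map_eq_zero _).2 fun v hv ↦ by
      by_contra h
      exact (g.pos x v h).ne' (by simpa using congr($hv v)))
    (by
      rw [← (LinearMap.toContinuousLinearMap (𝕜 := ℝ) (E := TangentSpace I x)
        (F' := ℝ)).finrank_eq]
      exact Subspace.dual_finrank_eq.symm)).toContinuousLinearEquiv

@[simp] theorem flat_apply (v w : TangentSpace I x) : flat g x v w = g.inner x v w := rfl

theorem ext_of_inner {v v' : TangentSpace I x}
    (h : ∀ w, 2 * g.inner x v w = 2 * g.inner x v' w) : v = v' :=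
  (flat g x).injective (by ext w; simpa using h w)

open scoped Classical in
/-- The covariant derivative of the Levi-Civita connection, as a bare function: `∇_X Y` at `x` is
`leviCivitaAux g Y x (X x)`. It is only meaningful where `Y` is differentiable. -/
def leviCivitaAux (Y : ∀ x : M, TangentSpace I x) (x : M) :
    TangentSpace I x →L[ℝ] TangentSpace I x :=
  if hY : MDiffAt (T% Y) x then
    (1 / 2 : ℝ) • ((flat g x).symm.toContinuousLinearMap ∘L koszulForm g Y x hY)
  else 0

theorem leviCivitaAux_koszul (hX : MDiffAt (T% X) x) (hY : MDiffAt (T% Y) x)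
    (hZ : MDiffAt (T% Z) x) :
    2 * g.inner x (leviCivitaAux g Y x (X x)) (Z x) = koszul g X Y Z x := by
  rw [← koszulForm_apply g hX hY hZ, leviCivitaAux, dif_pos hY, ← flat_apply]
  simp

/-- The Levi-Civita connection of a Riemannian metric, given by the Koszul formula. -/
def leviCivita : CovariantDerivative I E (TangentSpace I : M → Type _) where
  toFun := leviCivitaAux g
  isCovariantDerivativeOnUniv :=
    { add := by
        intro Y Y' x hY hY' _
        have hYY : MDiffAt (T% (Y + Y')) x := mdifferentiableAt_add_section hY hY'
        ext1 v
        refine ext_of_inner g fun w ↦ ?_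
        have hv := FiberBundle.mdifferentiableAt_extend I E v
        have hw := FiberBundle.mdifferentiableAt_extend I E w
        have h := leviCivitaAux_koszul g hv hYY hw
        rw [koszul_add_mid g hv hY hY' hw, ← leviCivitaAux_koszul g hv hY hw,
          ← leviCivitaAux_koszul g hv hY' hw] at h
        simp only [FiberBundle.extend_apply_self] at h
        simp [h, mul_add]
      leibniz := by
        intro Y f x hY hf _
        have hfY : MDiffAt (T% (f • Y)) x := hf.smul_section hY
        ext1 v
        refine ext_of_inner g fun w ↦ ?_
        have hv := FiberBundle.mdifferentiableAt_extend I E v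
        have hw := FiberBundle.mdifferentiableAt_extend I E w
        have h := leviCivitaAux_koszul g hv hfY hw
        rw [koszul_smul_mid g hf hv hY hw, ← leviCivitaAux_koszul g hv hY hw] at h
        simp only [FiberBundle.extend_apply_self] at h
        rw [h]
        simp
        ring }

/-- The Koszul formula. -/
theorem leviCivita_koszul (hX : MDiffAt (T% X) x) (hY : MDiffAt (T% Y) x)
    (hZ : MDiffAt (T% Z) x) :
    2 * g.inner x (leviCivita g Y x (X x)) (Z x) = koszul g X Y Z x :=
  leviCivitaAux_koszul g hX hY hZ

/-- The Levi-Civita connection is torsion-free. -/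
theorem leviCivita_torsion : (leviCivita g).torsion = 0 := by
  rw [CovariantDerivative.torsion_eq_zero_iff]
  intro X Y x hX hY
  refine ext_of_inner g fun w ↦ ?_
  have hw := FiberBundle.mdifferentiableAt_extend I E w
  have h1 := leviCivita_koszul g hX hY hw
  have h2 := leviCivita_koszul g hY hX hw
  simp only [koszul, FiberBundle.extend_apply_self, mlieBracket_swap_apply (V := Y) (W := X),
    map_neg, _root_.neg_apply] at h1 h2
  have h3 : (fun y ↦ g.inner y (Y y) (X y)) = fun y ↦ g.inner y (X y) (Y y) :=
    funext fun y ↦ g.symm y _ _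
  rw [h3] at h2
  simp only [map_sub, _root_.sub_apply]
  linarith

/-- The Levi-Civita connection is metric. -/
theorem leviCivita_metric (hX : MDiffAt (T% X) x) (hY : MDiffAt (T% Y) x)
    (hZ : MDiffAt (T% Z) x) :
    mvfderiv I (fun y ↦ g.inner y (Y y) (Z y)) x (X x) =
      g.inner x (leviCivita g Y x (X x)) (Z x) + g.inner x (Y x) (leviCivita g Z x (X x)) := by
  have h1 := leviCivita_koszul g hX hY hZ
  have h2 := leviCivita_koszul g hX hZ hY
  have h3 : (fun y ↦ g.inner y (Z y) (Y y)) = fun y ↦ g.inner y (Y y) (Z y) :=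
    funext fun y ↦ g.symm y _ _
  simp only [koszul, h3, mlieBracket_swap_apply (V := Z) (W := Y), map_neg,
    _root_.neg_apply] at h1 h2
  rw [g.symm x (Y x)]
  linarith

/-- The curvature `R(X,Y)Z = ∇_X ∇_Y Z - ∇_Y ∇_X Z - ∇_[X,Y] Z` of the Levi-Civita connection. -/
def curvature (X Y Z : ∀ x : M, TangentSpace I x) (x : M) : TangentSpace I x :=
  leviCivita g (fun y ↦ leviCivita g Z y (Y y)) x (X x)
    - leviCivita g (fun y ↦ leviCivita g Z y (X y)) x (Y x)
    - leviCivita g Z x (mlieBracket I X Y x)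

/-- The scalar curvature of `g`, as the trace `∑ₐ ∑ᵦ g(R(eₐ,eᵦ)eᵦ, eₐ)` over a smooth `g`-orthonormal
frame `e` (the value does not depend on the choice of this frame). It is positive on spheres. -/
def scalarCurvature {ι : Type*} [Fintype ι] (e : ι → ∀ x : M, TangentSpace I x) (x : M) : ℝ :=
  ∑ a, ∑ b, g.inner x (curvature g (e a) (e b) (e b) x) (e a x)

end Riemannian

/-- The model space of three-manifolds. -/
abbrev E3 : Type := EuclideanSpace ℝ (Fin 3)

theorem contMDiffAt_smulRight {M : Type*} [TopologicalSpace M] [ChartedSpace E3 M]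
    {G : Type*} [NormedAddCommGroup G] [NormedSpace ℝ G]
    {φ : M → E3 →L[ℝ] ℝ} {c : M → G} {x₀ : M}
    (hφ : ContMDiffAt (𝓡 3) 𝓘(ℝ, E3 →L[ℝ] ℝ) ∞ φ x₀) (hc : ContMDiffAt (𝓡 3) 𝓘(ℝ, G) ∞ c x₀) :
    ContMDiffAt (𝓡 3) 𝓘(ℝ, E3 →L[ℝ] G) ∞ (fun x ↦ (φ x).smulRight (c x)) x₀ :=
  (isBoundedBilinearMap_smulRight (𝕜 := ℝ) (E := E3) (F := G)).contDiff.contMDiff.contMDiffAt.comp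
    x₀ (hφ.prodMk_space hc)

section Tensors

variable (M : Type*) [TopologicalSpace M] [ChartedSpace E3 M] [IsManifold (𝓡 3) ∞ M]

/-- Smooth vector fields. -/
abbrev VectorField : Type _ := Cₛ^∞⟮𝓡 3; E3, (TangentSpace (𝓡 3) : M → Type _)⟯

/-- Smooth one-forms. -/
abbrev OneForm : Type _ :=
  Cₛ^∞⟮𝓡 3; E3 →L[ℝ] ℝ, (fun x : M ↦ TangentSpace (𝓡 3) x →L[ℝ] ℝ)⟯

/-- Smooth sections of `T*M ⊗ T*M`. -/
abbrev BilinForm : Type _ :=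
  Cₛ^∞⟮𝓡 3; E3 →L[ℝ] E3 →L[ℝ] ℝ,
    (fun x : M ↦ TangentSpace (𝓡 3) x →L[ℝ] TangentSpace (𝓡 3) x →L[ℝ] ℝ)⟯

/-- A smooth global coframe: three smooth one-forms `(e_u, e_l, e_n)`, indexed by `0, 1, 2`, that
form a basis of each cotangent space. -/
structure Coframe where
  form : Fin 3 → OneForm M
  linearIndependent : ∀ x, LinearIndependent ℝ fun a ↦ form a x

/-- A Cauchy pair: a coframe and a symmetric bilinear form `Θ`. -/
structure CauchyPair where
  coframe : Coframe M
  Θ : BilinForm M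
  symm : ∀ x v w, Θ x v w = Θ x w v

end Tensors

section
variable {M : Type*} [TopologicalSpace M] [ChartedSpace E3 M] [IsManifold (𝓡 3) ∞ M]

theorem OneForm.mdifferentiableAt_apply (α : OneForm M)
    {Y : ∀ x : M, TangentSpace (𝓡 3) x} {x : M}
    (hY : MDifferentiableAt (𝓡 3) ((𝓡 3).prod 𝓘(ℝ, E3)) (fun y ↦ TotalSpace.mk' E3 y (Y y)) x) :
    MDifferentiableAt (𝓡 3) 𝓘(ℝ) (fun y ↦ α y (Y y)) x := by
  have h : MDifferentiableAt (𝓡 3) ((𝓡 3).prod 𝓘(ℝ))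
      (fun m ↦ TotalSpace.mk' ℝ (E := Bundle.Trivial M ℝ) m (α m (Y m))) x := by
    apply MDifferentiableAt.clm_bundle_apply (F₁ := E3)
    · exact α.mdifferentiableAt
    · exact hY
  simp only [mdifferentiableAt_totalSpace] at h
  exact h.2

/-- A one-form read in the trivialization at `x₀` is smooth at `x₀`. -/
theorem OneForm.contMDiffAt_coord (α : OneForm M) (x₀ : M) :
    ContMDiffAt (𝓡 3) 𝓘(ℝ, E3 →L[ℝ] ℝ) ∞
      (fun x ↦ (α x).comp ((trivializationAt E3 (TangentSpace (𝓡 3)) x₀).symmL ℝ x)) x₀ := by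
  have h := ((contMDiffAt_hom_bundle _).1 (α.contMDiff x₀)).2
  simpa [ContinuousLinearMap.inCoordinates] using h

namespace Coframe
variable (e : Coframe M)

theorem eq_zero {x : M} {v : TangentSpace (𝓡 3) x} (h : ∀ a, e.form a x v = 0) : v = 0 := by
  have hF : FiniteDimensional ℝ (TangentSpace (𝓡 3) x) :=
    inferInstanceAs (FiniteDimensional ℝ E3)
  have hT : T2Space (TangentSpace (𝓡 3) x) := inferInstanceAs (T2Space E3)
  have hc : Fintype.card (Fin 3) = Module.finrank ℝ (TangentSpace (𝓡 3) x →L[ℝ] ℝ) := by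
    rw [← (LinearMap.toContinuousLinearMap (𝕜 := ℝ) (E := TangentSpace (𝓡 3) x)
      (F' := ℝ)).finrank_eq]
    refine Eq.trans ?_ Subspace.dual_finrank_eq.symm
    exact (Fintype.card_fin 3).trans (finrank_euclideanSpace_fin (𝕜 := ℝ) (n := 3)).symm
  have : FiniteDimensional ℝ (TangentSpace (𝓡 3) x →L[ℝ] ℝ) :=
    (LinearMap.toContinuousLinearMap (𝕜 := ℝ) (E := TangentSpace (𝓡 3) x)
      (F' := ℝ)).finiteDimensional
  have hs := (e.linearIndependent x).span_eq_top_of_card_eq_finrank' hc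
  have hall : ∀ φ : TangentSpace (𝓡 3) x →L[ℝ] ℝ, φ v = 0 := by
    intro φ
    have hφ : φ ∈ Submodule.span ℝ (Set.range fun a ↦ e.form a x) := hs ▸ Submodule.mem_top
    induction hφ using Submodule.span_induction with
    | mem y hy => obtain ⟨a, rfl⟩ := hy; exact h a
    | zero => rfl
    | add y z _ _ hy hz => simp [hy, hz]
    | smul c y _ hy => simp [hy]
  have h0 : (innerSL ℝ : E3 →L[ℝ] E3 →L[ℝ] ℝ) v v = 0 :=
    hall ((innerSL ℝ : E3 →L[ℝ] E3 →L[ℝ] ℝ) v)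
  exact (inner_self_eq_zero (𝕜 := ℝ) (E := E3)).1 h0

/-- The coframe at a point, as a linear isomorphism `v ↦ (e_u(v), e_l(v), e_n(v))`. -/
def equiv (x : M) : TangentSpace (𝓡 3) x ≃L[ℝ] (Fin 3 → ℝ) :=
  have : FiniteDimensional ℝ (TangentSpace (𝓡 3) x) := inferInstanceAs (FiniteDimensional ℝ E3)
  have : T2Space (TangentSpace (𝓡 3) x) := inferInstanceAs (T2Space E3)
  (LinearEquiv.ofInjectiveOfFinrankEq
    (ContinuousLinearMap.pi fun a ↦ e.form a x : TangentSpace (𝓡 3) x →L[ℝ] (Fin 3 → ℝ)).toLinearMap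
    ((injective_iff_map_eq_zero _).2 fun v hv ↦ e.eq_zero fun a ↦ congrFun hv a)
    ((finrank_euclideanSpace (𝕜 := ℝ) (ι := Fin 3)).trans (by simp))).toContinuousLinearEquiv

@[simp] theorem equiv_apply (x : M) (v : TangentSpace (𝓡 3) x) (a : Fin 3) :
    e.equiv x v a = e.form a x v := rfl

/-- The frame dual to a coframe, `e_b (frame a) = δ_ab`. -/
def dualFrame (a : Fin 3) (x : M) : TangentSpace (𝓡 3) x :=
  (e.equiv x).symm (Pi.single a 1)

theorem form_dualFrame (a b : Fin 3) (x : M) :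
    e.form b x (e.dualFrame a x) = if b = a then 1 else 0 := by
  rw [← equiv_apply, dualFrame, ContinuousLinearEquiv.apply_symm_apply, Pi.single_apply]

theorem contMDiff_dualFrame (a : Fin 3) :
    ContMDiff (𝓡 3) ((𝓡 3).prod 𝓘(ℝ, E3)) ∞ (fun x ↦ TotalSpace.mk' E3 x (e.dualFrame a x)) := by
  intro x₀
  set t := trivializationAt E3 (TangentSpace (𝓡 3) : M → Type _) x₀ with ht
  let A : M → E3 →L[ℝ] (Fin 3 → ℝ) := fun x ↦ ∑ b,
    ((e.form b x).comp (t.symmL ℝ x)).smulRight (Pi.single b 1 : Fin 3 → ℝ)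
  have hA : ContMDiffAt (𝓡 3) 𝓘(ℝ, E3 →L[ℝ] (Fin 3 → ℝ)) ∞ A x₀ := by
    refine ContMDiffAt.sum fun b _ ↦ ?_
    exact contMDiffAt_smulRight ((e.form b).contMDiffAt_coord x₀) contMDiffAt_const
  have hmem : x₀ ∈ t.baseSet := FiberBundle.mem_baseSet_trivializationAt E3 _ x₀
  have hAe : ∀ x (hx : x ∈ t.baseSet),
      A x = ((t.continuousLinearEquivAt ℝ x hx).symm.trans (e.equiv x) :
        E3 →L[ℝ] (Fin 3 → ℝ)) := by
    intro x hx
    ext v c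
    simp [A, Pi.single_apply, t.symmL_apply hx]
  rw [contMDiffAt_totalSpace]
  refine ⟨contMDiffAt_id, ?_⟩
  have hinv : ContMDiffAt (𝓡 3) 𝓘(ℝ, E3) ∞ (fun x ↦ (A x).inverse (Pi.single a 1)) x₀ := by
    refine ContMDiffAt.clm_apply ?_ contMDiffAt_const
    have h1 : ContDiffAt ℝ ∞ ContinuousLinearMap.inverse (A x₀) := by
      rw [hAe x₀ hmem]
      exact contDiffAt_map_inverse _
    exact h1.contMDiffAt.comp x₀ hA
  refine hinv.congr_of_eventuallyEq ?_
  filter_upwards [t.open_baseSet.mem_nhds hmem] with x hx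
  rw [hAe x hx, ContinuousLinearMap.inverse_equiv]
  rfl

theorem contMDiff_metric :
    ContMDiff (𝓡 3) ((𝓡 3).prod 𝓘(ℝ, E3 →L[ℝ] E3 →L[ℝ] ℝ)) ∞
      (fun x ↦ TotalSpace.mk' (E3 →L[ℝ] E3 →L[ℝ] ℝ) x
        (∑ a, (e.form a x).smulRight (e.form a x) :
          TangentSpace (𝓡 3) x →L[ℝ] TangentSpace (𝓡 3) x →L[ℝ] ℝ)) := by
  intro x₀
  rw [contMDiffAt_hom_bundle]
  refine ⟨contMDiffAt_id, ?_⟩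
  set t := trivializationAt E3 (TangentSpace (𝓡 3) : M → Type _) x₀ with ht
  have hmem : x₀ ∈ t.baseSet := FiberBundle.mem_baseSet_trivializationAt E3 _ x₀
  have hA : ContMDiffAt (𝓡 3) 𝓘(ℝ, E3 →L[ℝ] E3 →L[ℝ] ℝ) ∞ (fun x ↦
      ∑ b, ((e.form b x).comp (t.symmL ℝ x)).smulRight
        ((e.form b x).comp (t.symmL ℝ x))) x₀ := by
    refine ContMDiffAt.sum fun b _ ↦ ?_
    exact contMDiffAt_smulRight ((e.form b).contMDiffAt_coord x₀)
      ((e.form b).contMDiffAt_coord x₀)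
  refine hA.congr_of_eventuallyEq ?_
  filter_upwards [t.open_baseSet.mem_nhds hmem] with x hx
  ext v w
  rw [inCoordinates_apply_eq₂ hx hx (Set.mem_univ x)]
  simp [t.symmL_apply hx, ← ht]

/-- The Riemannian metric `e_u ⊗ e_u + e_l ⊗ e_l + e_n ⊗ e_n` of a coframe. -/
def metric : ContMDiffRiemannianMetric (𝓡 3) ∞ E3 (TangentSpace (𝓡 3) : M → Type _) where
  inner x := ∑ a, (e.form a x).smulRight (e.form a x)
  symm x v w := by
    simp [mul_comm]
  pos x v hv := by
    have h : ∃ a, e.form a x v ≠ 0 := by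
      by_contra! h
      exact hv (e.eq_zero h)
    obtain ⟨a, ha⟩ := h
    simp only [FunLike.coe_sum, Finset.sum_apply, ContinuousLinearMap.smulRight_apply,
      _root_.smul_apply, smul_eq_mul]
    exact Finset.sum_pos' (fun b _ ↦ mul_self_nonneg _)
      ⟨a, Finset.mem_univ a, mul_self_pos.2 ha⟩
  isVonNBounded x := by
    have hb : Bornology.IsVonNBounded ℝ (Metric.ball (0 : Fin 3 → ℝ) 1) :=
      NormedSpace.isVonNBounded_ball ℝ _ _
    refine (hb.image (e.equiv x).symm.toContinuousLinearMap).subset fun v hv ↦ ?_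
    refine ⟨e.equiv x v, ?_, (e.equiv x).symm_apply_apply v⟩
    rw [mem_ball_zero_iff, pi_norm_lt_iff one_pos]
    intro a
    have hv' : ∑ b, e.form b x v * e.form b x v < 1 := by simpa using hv
    have ha : e.form a x v * e.form a x v ≤ ∑ b, e.form b x v * e.form b x v :=
      Finset.single_le_sum (f := fun b ↦ e.form b x v * e.form b x v)
        (fun b _ ↦ mul_self_nonneg _) (Finset.mem_univ a)
    rw [equiv_apply, Real.norm_eq_abs, abs_lt]
    constructor <;> nlinarith
  contMDiff := e.contMDiff_metric

@[simp] theorem metric_apply (x : M) (v w : TangentSpace (𝓡 3) x) :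
    e.metric.inner x v w = ∑ a, e.form a x v * e.form a x w := by
  simp [metric]

/-- The dual frame is orthonormal for the metric of the coframe. -/
theorem metric_dualFrame (a b : Fin 3) (x : M) :
    e.metric.inner x (e.dualFrame a x) (e.dualFrame b x) = if a = b then 1 else 0 := by
  simp [form_dualFrame, eq_comm]

end Coframe

/-- The exterior derivative `dα(X,Y) = X(α(Y)) - Y(α(X)) - α([X,Y])`. -/
def extDeriv (α : OneForm M) (X Y : VectorField M) (x : M) : ℝ :=
  mvfderiv (𝓡 3) (fun y ↦ α y (Y y)) x (X x) - mvfderiv (𝓡 3) (fun y ↦ α y (X y)) x (Y x)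
    - α x (mlieBracket (𝓡 3) X Y x)

/-- The wedge product `α ∧ β = α ⊗ β - β ⊗ α`. -/
def wedge (α β : OneForm M) (X Y : VectorField M) (x : M) : ℝ :=
  α x (X x) * β x (Y x) - β x (X x) * α x (Y x)

variable (M) in
/-- The closed one-forms. -/
def closedForms : Submodule ℝ (OneForm M) where
  carrier := {α | ∀ X Y x, extDeriv α X Y x = 0}
  zero_mem' X Y x := by
    simp [extDeriv, mvfderiv_const]
  add_mem' {α β} hα hβ X Y x := by
    have h1 := mvfderiv_add (α.mdifferentiableAt_apply (X.mdifferentiableAt (x := x)))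
      (β.mdifferentiableAt_apply (X.mdifferentiableAt (x := x)))
    have h2 := mvfderiv_add (α.mdifferentiableAt_apply (Y.mdifferentiableAt (x := x)))
      (β.mdifferentiableAt_apply (Y.mdifferentiableAt (x := x)))
    have hα := hα X Y x
    have hβ := hβ X Y x
    simp only [Pi.add_def] at h1 h2
    simp only [extDeriv] at hα hβ
    simp only [extDeriv, ContMDiffSection.coe_add, Pi.add_apply, _root_.add_apply, h1, h2]
    linarith
  smul_mem' c α hα X Y x := by
    have h1 := mvfderiv_mul (f := fun _ ↦ c) mdifferentiableAt_const
      (α.mdifferentiableAt_apply (X.mdifferentiableAt (x := x)))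
    have h2 := mvfderiv_mul (f := fun _ ↦ c) mdifferentiableAt_const
      (α.mdifferentiableAt_apply (Y.mdifferentiableAt (x := x)))
    have hα := hα X Y x
    simp only [Pi.mul_def] at h1 h2
    simp only [extDeriv] at hα
    simp only [extDeriv, ContMDiffSection.coe_smul, Pi.smul_apply, _root_.smul_apply, smul_eq_mul,
      h1, h2, mvfderiv_const, _root_.add_apply, smul_zero, _root_.zero_apply]
    linear_combination c * hα

variable (M) in
/-- The exact one-forms `df`, with `f` a smooth function. -/
def exactForms : Submodule ℝ (OneForm M) where
  carrier := {α | ∃ f : C^∞⟮𝓡 3, M; ℝ⟯, ∀ x, α x = mvfderiv (𝓡 3) f x}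
  zero_mem' := ⟨0, fun x ↦ by simp⟩
  add_mem' := by
    rintro α β ⟨f, hf⟩ ⟨k, hk⟩
    refine ⟨f + k, fun x ↦ ?_⟩
    have h := mvfderiv_add (f.contMDiff.mdifferentiableAt (x := x) (by simp))
      (k.contMDiff.mdifferentiableAt (x := x) (by simp))
    simp only [ContMDiffMap.coe_add, ContMDiffSection.coe_add, Pi.add_apply, hf, hk, h]
  smul_mem' := by
    rintro c α ⟨f, hf⟩
    refine ⟨c • f, fun x ↦ ?_⟩
    have h := mvfderiv_smul (a := fun _ ↦ c) mdifferentiableAt_const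
      (f.contMDiff.mdifferentiableAt (x := x) (by simp))
    simp only [mvfderiv_const, ContinuousLinearMap.zero_smulRight, add_zero] at h
    simp only [ContMDiffSection.coe_smul, Pi.smul_apply, hf]
    exact h.symm

variable (M) in
/-- The first de Rham cohomology group `H¹(M, ℝ)`: closed one-forms modulo exact ones. -/
abbrev H1 : Type _ := closedForms M ⧸ (exactForms M).submoduleOf (closedForms M)

/-- `[α] = 0 ∈ H¹(M, ℝ)`: the one-form `α` is closed and its cohomology class vanishes. -/
def VanishingClass (α : OneForm M) : Prop :=
  ∃ h : α ∈ closedForms M, (Submodule.Quotient.mk ⟨α, h⟩ : H1 M) = 0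

namespace CauchyPair
variable (p : CauchyPair M)

/-- The one-form `Θ(e_a)`, i.e. `Θ(e_a♯, ·)`; for the metric of the coframe, the dual `e_a♯` is
the vector field `e_a` of the dual frame. -/
def shape (a : Fin 3) : OneForm M where
  toFun x := p.Θ x (p.coframe.dualFrame a x)
  contMDiff_toFun := by
    apply ContMDiff.clm_bundle_apply (F₁ := E3)
    · exact p.Θ.contMDiff
    · exact p.coframe.contMDiff_dualFrame a

/-- The trace of `Θ`. -/
def trace (x : M) : ℝ := ∑ a, p.Θ x (p.coframe.dualFrame a x) (p.coframe.dualFrame a x)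

/-- The squared norm `|Θ|²`. -/
def normSq (x : M) : ℝ :=
  ∑ a, ∑ b, p.Θ x (p.coframe.dualFrame a x) (p.coframe.dualFrame b x) ^ 2

/-- The covariant derivative `(∇_X Θ)(Y, Z)` for the Levi-Civita connection of the coframe. -/
def covDeriv (X Y Z : ∀ x : M, TangentSpace (𝓡 3) x) (x : M) : ℝ :=
  mvfderiv (𝓡 3) (fun y ↦ p.Θ y (Y y) (Z y)) x (X x)
    - p.Θ x (leviCivita p.coframe.metric Y x (X x)) (Z x)
    - p.Θ x (Y x) (leviCivita p.coframe.metric Z x (X x))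

/-- The divergence `div(Θ)(Y) = ∑ₐ (∇_{eₐ} Θ)(eₐ, Y)`. -/
def div (Y : ∀ x : M, TangentSpace (𝓡 3) x) (x : M) : ℝ :=
  ∑ a, p.covDeriv (p.coframe.dualFrame a) (p.coframe.dualFrame a) Y x

/-- The exterior system `de_a = Θ(e_a) ∧ e_u` for the form `e_a`. -/
def ExteriorEq (a : Fin 3) : Prop :=
  ∀ X Y x, extDeriv (p.coframe.form a) X Y x = wedge (p.shape a) (p.coframe.form 0) X Y x

/-- Parallel Cauchy pairs. -/
def IsParallel : Prop := (∀ a, p.ExteriorEq a) ∧ VanishingClass (p.shape 0)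

/-- The Hamiltonian constraint `R = |Θ|² - Tr(Θ)²`. -/
def Hamiltonian : Prop :=
  ∀ x, scalarCurvature p.coframe.metric p.coframe.dualFrame x = p.normSq x - p.trace x ^ 2

/-- The momentum constraint `d Tr(Θ) = div(Θ)`. -/
def Momentum : Prop :=
  ∀ (Y : VectorField M) (x : M), mvfderiv (𝓡 3) p.trace x (Y x) = p.div Y x

/-- Constrained Ricci-flat parallel Cauchy pairs. -/
def IsConstrainedRicciFlat : Prop := p.IsParallel ∧ p.Hamiltonian ∧ p.Momentum

/-- `Θ` is a Codazzi tensor: `(∇_X Θ)(Y, Z) = (∇_Y Θ)(X, Z)`. -/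
def IsCodazzi : Prop :=
  ∀ (X Y Z : VectorField M) (x : M), p.covDeriv X Y Z x = p.covDeriv Y X Z x

end CauchyPair
end
end CauchyGeometry

end

noncomputable section

namespace CauchyGeometry

variable {M : Type*} [TopologicalSpace M] [ChartedSpace E3 M] [IsManifold (𝓡 3) ∞ M]

/-! Write `E_a` for the dual frame and `Θ_ab` for the components of `Θ` in it, with index 0 for `u`.
The proof is a moving-frame computation resting on the defect `m_c = div Θ(E_c) - E_c(Tr Θ)`.

The system (1) fixes all brackets: `[E_1, E_2] = 0`, and `[E_0, E_i] = ∑_a Θ_ai E_a` for `i ≠ 0`. By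
the Koszul formula the connection is then algebraic in `Θ`: `∇_v E_i = Θ(v, E_i) E_0` for `i ≠ 0`,
and `∇_v E_0` is minus the part of `Θ(v)` along `E_1`, `E_2`. So curvature and `∇Θ` involve only the
`Θ_ab` and their first derivatives, and comparing them gives `R = |Θ|² - Tr(Θ)² - 2 m_0`
(`scalarCurvature_eq`). The Hamiltonian constraint is therefore exactly `m_0 = 0`.

The other two components vanish by integrability (`momentumDefect_one`, `momentumDefect_two`): their
derivative terms are antisymmetrized derivatives of `Θ`, which are given by closedness of `Θ(e_u)`
and by the Jacobi identity of the frame (that is, `d² e_k = 0`). Hence for parallel pairs the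
Hamiltonian and momentum constraints are equivalent. A Codazzi form satisfies the momentum
constraint by tracing the Codazzi equation, and the equivalence then yields the Hamiltonian one. -/

/-- Differentiability at a point of a vector field, given as a bare function. -/
abbrev DiffField (Y : ∀ x : M, TangentSpace (𝓡 3) x) (x : M) : Prop :=
  MDifferentiableAt (𝓡 3) ((𝓡 3).prod 𝓘(ℝ, E3)) (fun y ↦ TotalSpace.mk' E3 y (Y y)) x

/-! ### Calculus in the dual frame. -/

namespace Coframe
variable (e : Coframe M)

theorem ext_form {x : M} {v w : TangentSpace (𝓡 3) x}
    (h : ∀ a, e.form a x v = e.form a x w) : v = w :=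
  sub_eq_zero.1 (e.eq_zero fun a ↦ by rw [map_sub, h a, sub_self])

/-- The expansion of a tangent vector in the dual frame. -/
theorem eq_sum_dualFrame {x : M} (v : TangentSpace (𝓡 3) x) :
    v = ∑ a, e.form a x v • e.dualFrame a x :=
  e.ext_form fun b ↦ by simp [form_dualFrame]

/-- The vector fields of the dual frame, as smooth sections. -/
def dualField (a : Fin 3) : VectorField M := ⟨e.dualFrame a, e.contMDiff_dualFrame a⟩

theorem mdifferentiableAt_dualFrame (a : Fin 3) (x : M) : DiffField (e.dualFrame a) x :=
  (e.contMDiff_dualFrame a).mdifferentiableAt (by simp)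

theorem metric_dualFrame_right {x : M} (v : TangentSpace (𝓡 3) x) (a : Fin 3) :
    e.metric.inner x v (e.dualFrame a x) = e.form a x v := by
  simp [form_dualFrame]

theorem metric_dualFrame_left {x : M} (v : TangentSpace (𝓡 3) x) (a : Fin 3) :
    e.metric.inner x (e.dualFrame a x) v = e.form a x v := by
  simp [form_dualFrame]

theorem mvfderiv_form_dualFrame (a b : Fin 3) (x : M) :
    mvfderiv (𝓡 3) (fun y ↦ e.form a y (e.dualFrame b y)) x = 0 := by
  simp only [form_dualFrame]
  exact mvfderiv_const _

/-- The pairings `e_a(E_b)` are constant, so only the bracket term survives; this turns (1) into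
formulas for the brackets of the frame. -/
theorem extDeriv_dualField (a b c : Fin 3) (x : M) :
    extDeriv (e.form a) (e.dualField b) (e.dualField c) x
      = - e.form a x (mlieBracket (𝓡 3) (e.dualFrame b) (e.dualFrame c) x) := by
  have hb := e.mvfderiv_form_dualFrame a b x
  have hc := e.mvfderiv_form_dualFrame a c x
  simp only [extDeriv, dualField, ContMDiffSection.coeFn_mk, hb, hc]
  simp

/-- A vector field is differentiable if its components in the dual frame are. -/
theorem diffField_of_form {W : ∀ x : M, TangentSpace (𝓡 3) x} {x : M}
    (hW : ∀ a, MDifferentiableAt (𝓡 3) 𝓘(ℝ) (fun y ↦ e.form a y (W y)) x) : DiffField W x := by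
  have hm (a : Fin 3) : DiffField ((fun y ↦ e.form a y (W y)) • e.dualFrame a) x :=
    (hW a).smul_section (e.mdifferentiableAt_dualFrame a x)
  have h := mdifferentiableAt_add_section (hm 0) (mdifferentiableAt_add_section (hm 1) (hm 2))
  convert h using 3
  ext1 y
  conv_lhs => rw [e.eq_sum_dualFrame (W y)]
  simp [Fin.sum_univ_three, add_assoc]

end Coframe

/-! ### Components of `Θ` and their derivatives. -/

namespace CauchyPair
variable (p : CauchyPair M)

/-- The component of `Θ` along the dual frame vectors `a` and `b`. -/
def coeff (a b : Fin 3) (x : M) : ℝ :=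
  p.Θ x (p.coframe.dualFrame a x) (p.coframe.dualFrame b x)

theorem coeff_comm (a b : Fin 3) : p.coeff a b = p.coeff b a :=
  funext fun x ↦ p.symm x _ _

theorem mdifferentiableAt_apply {Y Z : ∀ x : M, TangentSpace (𝓡 3) x} {x : M}
    (hY : DiffField Y x) (hZ : DiffField Z x) :
    MDifferentiableAt (𝓡 3) 𝓘(ℝ) (fun y ↦ p.Θ y (Y y) (Z y)) x := by
  have h : MDifferentiableAt (𝓡 3) ((𝓡 3).prod 𝓘(ℝ))
      (fun m ↦ TotalSpace.mk' ℝ (E := Bundle.Trivial M ℝ) m (p.Θ m (Y m) (Z m))) x := by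
    apply MDifferentiableAt.clm_bundle_apply₂ (F₁ := E3) (F₂ := E3)
    · exact p.Θ.mdifferentiableAt
    · exact hY
    · exact hZ
  simp only [mdifferentiableAt_totalSpace] at h
  exact h.2

theorem mdifferentiableAt_coeff (a b : Fin 3) (x : M) : MDifferentiableAt (𝓡 3) 𝓘(ℝ) (p.coeff a b) x :=
  p.mdifferentiableAt_apply (p.coframe.mdifferentiableAt_dualFrame a x)
    (p.coframe.mdifferentiableAt_dualFrame b x)

/-- The derivative of the component `Θ(e_b, e_c)` along the dual frame vector `a`. -/
def dcoeff (a b c : Fin 3) (x : M) : ℝ :=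
  mvfderiv (𝓡 3) (p.coeff b c) x (p.coframe.dualFrame a x)

theorem dcoeff_comm (a b c : Fin 3) (x : M) : p.dcoeff a b c x = p.dcoeff a c b x := by
  rw [dcoeff, coeff_comm, dcoeff]

variable {p}

/-! ### Structure functions, connection and `∇Θ`. -/

/-- The structure functions of the dual frame of a solution of the exterior system. -/
theorem form_mlieBracket (hp : ∀ a, p.ExteriorEq a) (a b c : Fin 3) (x : M) :
    p.coframe.form a x (mlieBracket (𝓡 3) (p.coframe.dualFrame b) (p.coframe.dualFrame c) x)
      = (if 0 = b then p.coeff a c x else 0) - if 0 = c then p.coeff a b x else 0 := by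
  have h := hp a (p.coframe.dualField b) (p.coframe.dualField c) x
  rw [Coframe.extDeriv_dualField] at h
  simp only [wedge, shape, Coframe.dualField, ContMDiffSection.coeFn_mk,
    Coframe.form_dualFrame] at h
  simp only [coeff]
  split_ifs at h ⊢ <;> linarith

/-- The Levi-Civita connection of a solution of the exterior system in the dual frame. -/
theorem form_leviCivita_dualFrame (hp : ∀ a, p.ExteriorEq a) (b c : Fin 3) (x : M)
    (v : TangentSpace (𝓡 3) x) :
    p.coframe.form c x (leviCivita p.coframe.metric (p.coframe.dualFrame b) x v)
      = (if 0 = c then p.Θ x v (p.coframe.dualFrame b x) else 0)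
        - if 0 = b then p.Θ x v (p.coframe.dualFrame c x) else 0 := by
  -- The metric is constant on frame fields, so only the three brackets in the Koszul expression
  -- remain. By symmetry of `Θ` their terms with `0 = a` cancel and the others double. General `v`
  -- follows by linearity.
  have key : ∀ a, p.coframe.form c x (leviCivita p.coframe.metric (p.coframe.dualFrame b) x
      (p.coframe.dualFrame a x)) = (if 0 = c then p.coeff a b x else 0)
        - if 0 = b then p.coeff a c x else 0 := by
    intro a
    have h := leviCivita_koszul p.coframe.metric
      (p.coframe.mdifferentiableAt_dualFrame a x) (p.coframe.mdifferentiableAt_dualFrame b x)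
      (p.coframe.mdifferentiableAt_dualFrame c x)
    simp only [koszul, Coframe.metric_dualFrame_right, Coframe.mvfderiv_form_dualFrame,
      form_mlieBracket hp, _root_.zero_apply] at h
    rw [p.coeff_comm c b, p.coeff_comm c a, p.coeff_comm b a] at h
    split_ifs at h ⊢ <;> linarith
  conv_lhs => rw [p.coframe.eq_sum_dualFrame v]
  conv_rhs => rw [p.coframe.eq_sum_dualFrame v]
  simp only [map_sum, map_smul, key, FunLike.coe_sum, Finset.sum_apply, _root_.smul_apply,
    smul_eq_mul, coeff]
  split_ifs <;> simp [Finset.sum_sub_distrib, mul_sub]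

theorem apply_leviCivita (hp : ∀ a, p.ExteriorEq a) (b : Fin 3) (x : M)
    (v w : TangentSpace (𝓡 3) x) :
    p.Θ x w (leviCivita p.coframe.metric (p.coframe.dualFrame b) x v)
      = p.Θ x v (p.coframe.dualFrame b x) * p.Θ x w (p.coframe.dualFrame 0 x)
        - if 0 = b then ∑ d, p.Θ x v (p.coframe.dualFrame d x) * p.Θ x w (p.coframe.dualFrame d x)
          else 0 := by
  rw [p.coframe.eq_sum_dualFrame (leviCivita _ _ _ _)]
  simp only [form_leviCivita_dualFrame hp]
  obtain rfl | h := eq_or_ne 0 b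
  · simp [Fin.sum_univ_three]; ring
  · simp [h]

theorem covDeriv_dualFrame (hp : ∀ a, p.ExteriorEq a) (a b c : Fin 3) (x : M) :
    p.covDeriv (p.coframe.dualFrame a) (p.coframe.dualFrame b) (p.coframe.dualFrame c) x
      = p.dcoeff a b c x
        - (p.coeff a b x * p.coeff c 0 x
          - if 0 = b then ∑ d, p.coeff a d x * p.coeff c d x else 0)
        - (p.coeff a c x * p.coeff b 0 x
          - if 0 = c then ∑ d, p.coeff a d x * p.coeff b d x else 0) := by
  rw [covDeriv, p.symm x _ (p.coframe.dualFrame c x), apply_leviCivita hp, apply_leviCivita hp]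
  rfl

/-! ### Integrability: closedness of `Θ(e_u)` and the Jacobi identity. -/

/-- Evaluating `dΘ(e_u) = 0` on `E_b`, `E_c` equates the derivative terms with `Θ(E_0, [E_b, E_c])`,
which is quadratic in `Θ`. The pairs `(0, 1)` and `(0, 2)` are the ones needed for the momentum
constraint. -/
theorem closed_coeff (hp : ∀ a, p.ExteriorEq a) (hc : p.shape 0 ∈ closedForms M)
    (b c : Fin 3) (x : M) :
    p.dcoeff b 0 c x - p.dcoeff c 0 b x
      = (if 0 = b then ∑ d, p.coeff 0 d x * p.coeff d c x else 0)
        - if 0 = c then ∑ d, p.coeff 0 d x * p.coeff d b x else 0 := by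
  have h := hc (p.coframe.dualField b) (p.coframe.dualField c) x
  simp only [extDeriv, shape, Coframe.dualField, ContMDiffSection.coeFn_mk] at h
  rw [p.coframe.eq_sum_dualFrame (mlieBracket (𝓡 3) _ _ x)] at h
  simp only [form_mlieBracket hp, map_sum, map_smul, smul_eq_mul] at h
  change p.dcoeff b 0 c x - p.dcoeff c 0 b x
    - ∑ d, (_ - _) * p.coeff 0 d x = 0 at h
  rw [sub_eq_zero.1 h]
  split_ifs <;> simp [mul_comm, Finset.sum_sub_distrib, sub_mul]

/-- The Jacobi identity for the dual frame. -/
theorem jacobi_coeff (hp : ∀ a, p.ExteriorEq a) (k : Fin 3) (x : M) :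
    p.dcoeff 1 k 2 x - p.dcoeff 2 k 1 x
      = p.coeff k 1 x * p.coeff 0 2 x - p.coeff 0 1 x * p.coeff k 2 x := by
  set E := p.coframe.dualFrame with hE
  have hs (a : Fin 3) : ContMDiffAt (𝓡 3) ((𝓡 3).prod 𝓘(ℝ, E3)) (minSmoothness ℝ 2)
      (fun y ↦ TotalSpace.mk' E3 y (E a y)) x :=
    ((p.coframe.contMDiff_dualFrame a).of_le (by simpa using ENat.LEInfty.out)) x
  have : IsManifold (𝓡 3) (minSmoothness ℝ 3) M := IsManifold.of_le (n := ∞) (by simpa using ENat.LEInfty.out)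
  -- The `k`-component of this identity is `d² e_k = 0`, that is `dΘ(e_k) ∧ e_u = Θ(e_k) ∧ Θ(e_u) ∧
  -- e_u`, evaluated on the triple `(E_0, E_1, E_2)`.
  have hJ := leibniz_identity_mlieBracket_apply (hs 0) (hs 1) (hs 2)
  have h12 : mlieBracket (𝓡 3) (E 1) (E 2) = 0 := by
    ext1 y
    refine p.coframe.eq_zero fun a ↦ ?_
    rw [form_mlieBracket hp]
    simp
  have h0 (i : Fin 3) (hi : i ≠ 0) : mlieBracket (𝓡 3) (E 0) (E i)
      = p.coeff 0 i • E 0 + (p.coeff 1 i • E 1 + p.coeff 2 i • E 2) := by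
    ext1 y
    refine p.coframe.ext_form fun a ↦ ?_
    rw [form_mlieBracket hp]
    simp only [hE, Pi.add_apply, Pi.smul_apply', map_add, map_smul, Coframe.form_dualFrame]
    fin_cases a <;> simp [hi.symm]
  have hm (a i : Fin 3) : DiffField (p.coeff a i • E a) x :=
    (p.mdifferentiableAt_coeff a i x).smul_section (p.coframe.mdifferentiableAt_dualFrame a x)
  have hd (a : Fin 3) : DiffField (E a) x := p.coframe.mdifferentiableAt_dualFrame a x
  have hc (a i : Fin 3) := p.mdifferentiableAt_coeff a i x
  have hm' (i : Fin 3) := mdifferentiableAt_add_section (hm 1 i) (hm 2 i)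
  -- Since `[E_1, E_2] = 0`, what is left is `[[E_0, E_1], E_2] + [E_1, [E_0, E_2]] = 0`. The
  -- Leibniz rule for brackets produces the derivatives of the `Θ_ab`.
  rw [h12, h0 1 (by simp), h0 2 (by simp), mlieBracket_zero_right,
    mlieBracket_add_left (hm 0 1) (hm' 1), mlieBracket_add_left (hm 1 1) (hm 2 1),
    mlieBracket_add_right (hm 0 2) (hm' 2), mlieBracket_add_right (hm 1 2) (hm 2 2)] at hJ
  simp only [mlieBracket_smul_left (hc _ _) (hd _), mlieBracket_smul_right (hc _ _) (hd _)] at hJ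
  have h := congrArg (p.coframe.form k x) hJ
  simp only [map_add, map_smul, form_mlieBracket hp, hE, Coframe.form_dualFrame, smul_eq_mul,
    Pi.zero_apply, map_zero] at h
  simp only [dcoeff]
  fin_cases k <;> simp at h ⊢ <;> linarith

/-! ### Ingredients of the curvature. -/

/-- Metric compatibility applied to `W` and `E_k`, with the known `∇E_k`. Curvature differentiates
`∇_{E_b} E_c`, which is not a frame field, so a general `W` is needed. -/
theorem form_leviCivita (hp : ∀ a, p.ExteriorEq a) {W : ∀ x : M, TangentSpace (𝓡 3) x} {x : M}
    (hW : DiffField W x) (a k : Fin 3) :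
    p.coframe.form k x (leviCivita p.coframe.metric W x (p.coframe.dualFrame a x))
      = mvfderiv (𝓡 3) (fun y ↦ p.coframe.form k y (W y)) x (p.coframe.dualFrame a x)
        + (if 0 = k then ∑ d, p.coeff a d x * p.coframe.form d x (W x) else 0)
        - p.coeff a k x * p.coframe.form 0 x (W x) := by
  have h := leviCivita_metric p.coframe.metric (p.coframe.mdifferentiableAt_dualFrame a x) hW
    (p.coframe.mdifferentiableAt_dualFrame k x)
  simp only [Coframe.metric_dualFrame_right] at h
  rw [h, Coframe.metric_apply]
  simp only [form_leviCivita_dualFrame hp, coeff, Fin.sum_univ_three]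
  obtain rfl | hk := eq_or_ne 0 k
  · simp; ring
  · simp [hk]; ring

theorem mvfderiv_form_leviCivita (hp : ∀ a, p.ExteriorEq a) (a b c k : Fin 3) (x : M) :
    mvfderiv (𝓡 3) (fun y ↦ p.coframe.form k y (leviCivita p.coframe.metric
        (p.coframe.dualFrame c) y (p.coframe.dualFrame b y))) x (p.coframe.dualFrame a x)
      = (if 0 = k then p.dcoeff a b c x else 0) - if 0 = c then p.dcoeff a b k x else 0 := by
  simp only [form_leviCivita_dualFrame hp]
  have hc := p.mdifferentiableAt_coeff b c x
  have hk := p.mdifferentiableAt_coeff b k x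
  have h := congrArg (fun φ ↦ φ (p.coframe.dualFrame a x)) (mvfderiv_sub hc hk)
  have hn := congrArg (fun φ ↦ φ (p.coframe.dualFrame a x))
    (mvfderiv_neg (I := 𝓡 3) (g := p.coeff b k) (x := x))
  split_ifs
  · exact h
  · simp only [sub_zero]; rfl
  · simp only [zero_sub]; exact hn
  · simp [mvfderiv_const]

/-- The components of `∇_{E_b} E_c` are entries of `Θ` up to sign, or combinations of them.
Differentiability is required before taking a second covariant derivative, because `leviCivitaAux`
is zero by default elsewhere. -/
theorem diffField_leviCivita (hp : ∀ a, p.ExteriorEq a) (b c : Fin 3) (x : M) :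
    DiffField (fun y ↦ leviCivita p.coframe.metric
        (p.coframe.dualFrame c) y (p.coframe.dualFrame b y)) x := by
  refine p.coframe.diffField_of_form fun k ↦ ?_
  simp only [form_leviCivita_dualFrame hp]
  have hc := p.mdifferentiableAt_coeff b c x
  have hk := p.mdifferentiableAt_coeff b k x
  split_ifs
  · exact hc.sub hk
  · simp only [sub_zero]; exact hc
  · simp only [zero_sub]; exact hk.neg
  · exact mdifferentiableAt_const

/-- Supplies the `∇_[X,Y]` term of the curvature, since `∇_v E_d` is expressed through values of
`Θ(v, ·)`. -/
theorem apply_mlieBracket (hp : ∀ a, p.ExteriorEq a) (b c d : Fin 3) (x : M) :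
    p.Θ x (mlieBracket (𝓡 3) (p.coframe.dualFrame b) (p.coframe.dualFrame c) x)
        (p.coframe.dualFrame d x)
      = (if 0 = b then ∑ a, p.coeff a c x * p.coeff a d x else 0)
        - if 0 = c then ∑ a, p.coeff a b x * p.coeff a d x else 0 := by
  rw [p.coframe.eq_sum_dualFrame (mlieBracket (𝓡 3) _ _ x)]
  simp only [form_mlieBracket hp, map_sum, map_smul, FunLike.coe_sum, Finset.sum_apply,
    _root_.smul_apply, smul_eq_mul]
  change ∑ a, _ * p.coeff a d x = _
  split_ifs <;> simp [Finset.sum_sub_distrib, sub_mul]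

/-! ### The momentum defect, its `u`-component as scalar curvature, and the vanishing of the other
two. -/

/-- The defect of the momentum constraint in the direction of the dual frame vector `c`. -/
def momentumDefect (p : CauchyPair M) (c : Fin 3) (x : M) : ℝ :=
  p.div (p.coframe.dualFrame c) x - mvfderiv (𝓡 3) p.trace x (p.coframe.dualFrame c x)

theorem mvfderiv_trace (c : Fin 3) (x : M) :
    mvfderiv (𝓡 3) p.trace x (p.coframe.dualFrame c x) = ∑ a, p.dcoeff c a a x := by
  have ht : p.trace = p.coeff 0 0 + (p.coeff 1 1 + p.coeff 2 2) := by
    ext1 y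
    simp [trace, coeff, Fin.sum_univ_three, add_assoc]
  have hd (a : Fin 3) := p.mdifferentiableAt_coeff a a x
  rw [ht, mvfderiv_add (hd 0) ((hd 1).add (hd 2)), mvfderiv_add (hd 1) (hd 2)]
  simp [dcoeff, Fin.sum_univ_three, add_assoc]

theorem momentumDefect_eq (hp : ∀ a, p.ExteriorEq a) (c : Fin 3) (x : M) :
    p.momentumDefect c x = ∑ a, (p.dcoeff a a c x
        - (p.coeff a a x * p.coeff c 0 x
          - if 0 = a then ∑ d, p.coeff a d x * p.coeff c d x else 0)
        - (p.coeff a c x * p.coeff a 0 x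
          - if 0 = c then ∑ d, p.coeff a d x * p.coeff a d x else 0)
        - p.dcoeff c a a x) := by
  rw [momentumDefect, mvfderiv_trace, div, ← Finset.sum_sub_distrib]
  simp only [covDeriv_dualFrame hp]

/-- The scalar curvature of a solution of the exterior system. -/
theorem scalarCurvature_eq (hp : ∀ a, p.ExteriorEq a) (x : M) :
    scalarCurvature p.coframe.metric p.coframe.dualFrame x
      = p.normSq x - p.trace x ^ 2 - 2 * p.momentumDefect 0 x := by
  -- The plane of `E_1`, `E_2` contributes no derivatives, because `∇_{E_i} E_j` is a multiple of
  -- `E_0` for `i, j ≠ 0`. The planes of `E_0`, `E_i` contribute `E_0 Θ_ii - E_i Θ_0i`, each counted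
  -- twice in the double sum: this is the derivative part of `-2 m_0`. The rest is quadratic in `Θ`.
  rw [momentumDefect_eq hp]
  simp only [scalarCurvature, Coframe.metric_dualFrame_right]
  simp only [curvature, map_sub, form_leviCivita hp (diffField_leviCivita hp _ _ x),
    mvfderiv_form_leviCivita hp]
  simp only [form_leviCivita_dualFrame hp, apply_mlieBracket hp, normSq, trace, ← coeff.eq_def,
    Fin.sum_univ_three]
  simp [p.coeff_comm 1 0, p.coeff_comm 2 0, p.coeff_comm 2 1, p.dcoeff_comm _ 1 0,
    p.dcoeff_comm _ 2 0]
  ring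

/-- The derivative terms are `E_0 Θ_01 - E_1 Θ_00`, given by closedness on `E_0`, `E_1`, and `E_2
Θ_21 - E_1 Θ_22`, given by the Jacobi identity with `k = 2`; the quadratic remainders cancel. For
`m_2` the indices 1 and 2 exchange roles. -/
theorem momentumDefect_one (hp : ∀ a, p.ExteriorEq a) (hc : p.shape 0 ∈ closedForms M) (x : M) :
    p.momentumDefect 1 x = 0 := by
  have h1 := closed_coeff hp hc 0 1 x
  have h2 := jacobi_coeff hp 2 x
  rw [momentumDefect_eq hp]
  simp only [Fin.sum_univ_three] at h1 ⊢
  simp [p.coeff_comm 1 0, p.coeff_comm 2 0, p.coeff_comm 2 1, p.dcoeff_comm _ 2 1] at h1 h2 ⊢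
  linarith

theorem momentumDefect_two (hp : ∀ a, p.ExteriorEq a) (hc : p.shape 0 ∈ closedForms M) (x : M) :
    p.momentumDefect 2 x = 0 := by
  have h1 := closed_coeff hp hc 0 2 x
  have h2 := jacobi_coeff hp 1 x
  rw [momentumDefect_eq hp]
  simp only [Fin.sum_univ_three] at h1 ⊢
  simp [p.coeff_comm 1 0, p.coeff_comm 2 0, p.coeff_comm 2 1] at h1 h2 ⊢
  linarith

/-! ### Equivalence of the two constraints. -/

/-- The divergence is tensorial. -/
theorem tensorialAt_div (p : CauchyPair M) (x : M) :
    TensorialAt (𝓡 3) E3 (fun Y : ∀ x : M, TangentSpace (𝓡 3) x ↦ p.div Y x) x where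
  smul {f Y} hf hY := by
    simp only [div, smul_eq_mul, Finset.mul_sum]
    refine Finset.sum_congr rfl fun a _ ↦ ?_
    -- The derivative of `f` arises once from differentiating `Θ(E_a, fY)` and once from `∇(fY)`,
    -- with opposite signs.
    have h1 := mvfderiv_mul hf
      (p.mdifferentiableAt_apply (p.coframe.mdifferentiableAt_dualFrame a x) hY)
    have h2 := (leviCivita p.coframe.metric).isCovariantDerivativeOnUniv.leibniz hY hf
    simp only [Pi.mul_def] at h1
    simp [covDeriv, h1, h2]
    ring
  add {Y Y'} hY hY' := by
    simp only [div, ← Finset.sum_add_distrib]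
    refine Finset.sum_congr rfl fun a _ ↦ ?_
    have h1 := mvfderiv_add
      (p.mdifferentiableAt_apply (p.coframe.mdifferentiableAt_dualFrame a x) hY)
      (p.mdifferentiableAt_apply (p.coframe.mdifferentiableAt_dualFrame a x) hY')
    have h2 := (leviCivita p.coframe.metric).isCovariantDerivativeOnUniv.add hY hY'
    simp only [Pi.add_def] at h1
    simp only [covDeriv, Pi.add_apply, map_add, _root_.add_apply, h1, h2]
    ring

/-- Both sides of the constraint are tensorial in `Y`, so it suffices to test it on the dual frame.
-/
theorem momentum_iff (p : CauchyPair M) : p.Momentum ↔ ∀ c x, p.momentumDefect c x = 0 := by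
  refine ⟨fun h c x ↦ sub_eq_zero.2 (h (p.coframe.dualField c) x).symm, fun h Y x ↦ ?_⟩
  have hY : DiffField Y x := Y.mdifferentiableAt
  have hE (c : Fin 3) := TensorialAt.mkHom_apply (p.tensorialAt_div x)
    (p.coframe.mdifferentiableAt_dualFrame c x)
  rw [← TensorialAt.mkHom_apply (p.tensorialAt_div x) hY, p.coframe.eq_sum_dualFrame (Y x)]
  simp only [map_sum, map_smul, hE]
  exact Finset.sum_congr rfl fun c _ ↦ by rw [sub_eq_zero.1 (h c x)]

/-- The curvature formula makes the Hamiltonian constraint equivalent to `m_0 = 0`; the components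
`m_1`, `m_2` vanish in any case. -/
theorem hamiltonian_iff_momentum (hp : ∀ a, p.ExteriorEq a) (hc : p.shape 0 ∈ closedForms M) :
    p.Hamiltonian ↔ p.Momentum := by
  simp only [Hamiltonian, momentum_iff, scalarCurvature_eq hp]
  refine ⟨fun h c x ↦ ?_, fun h x ↦ by rw [h]; ring⟩
  fin_cases c
  · have := h x
    simp only [Fin.zero_eta]
    linarith
  · exact momentumDefect_one hp hc x
  · exact momentumDefect_two hp hc x

/-! ### Codazzi forms. -/

theorem covDeriv_comm (p : CauchyPair M) (X Y Z : ∀ x : M, TangentSpace (𝓡 3) x) (x : M) :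
    p.covDeriv X Y Z x = p.covDeriv X Z Y x := by
  have h : (fun y ↦ p.Θ y (Y y) (Z y)) = fun y ↦ p.Θ y (Z y) (Y y) :=
    funext fun y ↦ p.symm y _ _
  rw [covDeriv, covDeriv, h, p.symm x _ (Z x), p.symm x (Y x)]
  ring

/-- Codazzi forms satisfy the momentum constraint. -/
theorem IsCodazzi.momentum (hp : ∀ a, p.ExteriorEq a) (h : p.IsCodazzi) : p.Momentum := by
  refine p.momentum_iff.2 fun c x ↦ ?_
  -- Symmetry in the last two slots followed by the Codazzi swap of the first two turns each term of
  -- the divergence into a term of the trace of `∇_{E_c} Θ`.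
  have hs (a : Fin 3) : p.covDeriv (p.coframe.dualFrame a) (p.coframe.dualFrame a)
      (p.coframe.dualFrame c) x
      = p.covDeriv (p.coframe.dualFrame c) (p.coframe.dualFrame a) (p.coframe.dualFrame a) x :=
    (p.covDeriv_comm _ _ _ x).trans
      (h (p.coframe.dualField a) (p.coframe.dualField c) (p.coframe.dualField a) x)
  rw [momentumDefect, mvfderiv_trace, div]
  -- That trace is the derivative of `Tr Θ`: the correction terms contract the symmetric `Θ` with
  -- the skew connection coefficients, so they sum to zero.
  simp only [hs, covDeriv_dualFrame hp, Fin.sum_univ_three]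
  simp [p.coeff_comm 1 0, p.coeff_comm 2 0]
  ring

end CauchyPair
end CauchyGeometry
end

theorem mainTheorem9 {M : Type*} [TopologicalSpace M] [T2Space M] [SecondCountableTopology M]
    [ChartedSpace CauchyGeometry.E3 M] [IsManifold (𝓡 3) ∞ M]
    (p : CauchyGeometry.CauchyPair M) :
    (p.IsConstrainedRicciFlat ↔
      (p.ExteriorEq 0 ∧ p.ExteriorEq 1 ∧ p.ExteriorEq 2) ∧
        CauchyGeometry.VanishingClass (p.shape 0) ∧ p.Hamiltonian) ∧
    (p.IsParallel → p.IsCodazzi → p.IsConstrainedRicciFlat) := by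
  refine ⟨⟨fun ⟨⟨he, hv⟩, hh, _⟩ ↦ ⟨⟨he 0, he 1, he 2⟩, hv, hh⟩, fun ⟨⟨h0, h1, h2⟩, hv, hh⟩ ↦ ?_⟩,
    fun ⟨he, hv⟩ hc ↦ ?_⟩
  · have he : ∀ a, p.ExteriorEq a := Fin.forall_fin_succ.2 ⟨h0, Fin.forall_fin_two.2 ⟨h1, h2⟩⟩
    -- `hv.1` is the closedness of `Θ(e_u)`, the part of (2) that enters the integrability argument.
    exact ⟨⟨he, hv⟩, hh, (CauchyGeometry.CauchyPair.hamiltonian_iff_momentum he hv.1).1 hh⟩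
  · have hm := hc.momentum he
    exact ⟨⟨he, hv⟩, (CauchyGeometry.CauchyPair.hamiltonian_iff_momentum he hv.1).2 hm, hm⟩
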